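/- Let $k,\ell\ge 0$ be integers, and let $\mathrm P^k_\ell$ be the set of integer sequences $\lambda=(\lambda_1,\dots,\lambda_\ell)$ with $k\ge\lambda_1\ge\dots\ge\lambda_\ell\ge 0$. **Notation.** Let $h_d$ be the complete homogeneous symmetric functions and put $k^{(r)}_m=\sum_{i=0}^m\binom{r+i-1}{i}h_{m-i}$ (so $k^{(0)}_m=h_m$, and $k_m^{(r)}=0$ for $m<0$). For $\gamma\in\mathbb Z^\ell$ put $g_\gamma=\det\big(k^{(i-1)}_{\gamma_i+j-i}\big)_{1\le i,j\le\ell}$. The operators $L_z$ and $R_{ij}$ act on subscripts: $L_z g_\gamma=g_{\gamma-\epsilon_z}$ and $R_{ij}g_\gamma=g_{\gamma+\epsilon_i-\epsilon_j}$, where $\epsilon_i$ is the $i$-th unit vector. A root ideal is a subset $\Psi$ of $\Delta^+_\ell=\{(i,j): 1\le i<j\le\ell\}$ such that $(a,b)\in\Psi$, $(c,d)\in\Delta^+_\ell$, $c\le a$ and $d\ge b$ imply $(c,d)\in\Psi$. For a root ideal $\Psi$, a finite multiset $M$ on $\{1,\dots,\ell\}$ and $\gamma\in\mathbb Z^\ell$,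 the Katalan function is $$K(\Psi;M;\gamma)=\prod_{z\in M}(1-L_z)\prod_{(i,j)\in\Psi}(1-R_{ij})^{-1}g_\gamma ,$$ where $(1-R_{ij})^{-1}=\sum_{n\ge0}R_{ij}^n$, all operators act on the subscripts of formal combinations, and only finitely many of the resulting terms are nonzero; $L_d$ applied to $K(\Psi;M;\gamma)$ means that $L_d$ acts on the subscripts of this formal combination as well. For $\lambda\in\mathrm P^k_\ell$ let $\Delta^k(\lambda)=\{(i,j)\in\Delta^+_\ell : k-\lambda_i+i<j\}$, which is a root ideal, and let $b_\lambda$ be the largest $i$ for which $\Delta^k(\lambda)$ contains some $(i,j)$ (with $b_\lambda=0$ if $\Delta^k(\lambda)=\emptyset$). Let $\mathrm{down}_\lambda(x)$ be the $j$ for which $(x,j)\in\Delta^k(\lambda)$ and $\Delta^k(\lambda)\setminus\{(x,j)\}$ is a root ideal; it is undefined if there is no such $j$. Let $\mathrm{down}^a_\lambda$ be its $a$-th iterate, with $\mathrm{down}_\lambda^0(x)=x$. Let $L(\Delta^k(\lambda))$ be the multiset of the second components $j$ of the elements $(i,j)$ of $\Delta^k(\lambda)$. For $1\le z\le b_\lambda+1$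 the $K$-$k$-Schur function of weight $z$ is $$g^{(z)}_\lambda=K\Big(\Delta^k(\lambda);\,L(\Delta^k(\lambda))\setminus\{\mathrm{down}_\lambda(x): z\le x\le b_\lambda\};\,\lambda\Big)$$ (multiset difference). **Proposition.** Let $\lambda\in\mathrm P^k_\ell$, $1\le z\le b_\lambda$ and $a\ge1$ be such that $1\le\mathrm{down}^{a-1}_\lambda(z)\le b_\lambda$ and $d:=\mathrm{down}^a_\lambda(z)$ satisfies $b_\lambda+1\le d\le\ell$. Put $\gamma=\lambda-\epsilon_d$. 1. If $\gamma\in\mathrm P^k_\ell$, then $L_d\,g^{(z)}_\lambda=g^{(z)}_\gamma$. 2. If $\gamma\notin\mathrm P^k_\ell$, and if $\lambda_z>\lambda_{z+1}$ in the case $\mathrm{down}^{a-1}_\lambda(z)\le b_\lambda-1$, then $L_d\,g^{(z)}_\lambda=0$. -/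

import Mathlib

noncomputable section

/-!  Indices: the positions `1, …, ℓ` of the mathematics are the elements `0, …, ℓ - 1` of `Fin ℓ`.
So the position `x : Fin ℓ` is the number `x + 1` in the 1-based convention.  -/

namespace KKSchur

open HahnSeries

/-! ### Complete homogeneous symmetric functions and the functions `g_γ` -/

/-- Formal power series with integer coefficients in countably many variables; the ring of
symmetric functions is a subring of it. -/
abbrev SymAmbient : Type := MvPowerSeries ℕ ℤ

/-- The complete homogeneous symmetric function `h_d`: the sum of all monomials of degree `d`. -/
def h (d : ℕ) : SymAmbient := fun m : ℕ →₀ ℕ => if m.degree = d then 1 else 0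

/-- `k_m^{(r)} = ∑_{i=0}^m binom(r+i-1, i) h_{m-i}`, which is `0` for `m < 0`.
For `r = 0` the truncated subtraction gives the values `1, 0, 0, …` (at `i = 0, 1, 2, …`) of the
binomial coefficient, so that `k_m^{(0)} = h_m`. -/
def kh (r : ℕ) (m : ℤ) : SymAmbient :=
  if m < 0 then 0
  else ∑ i ∈ Finset.range (m.toNat + 1), (((r + i - 1).choose i : ℕ) : SymAmbient) * h (m.toNat - i)

/-- `g_γ = det (k_{γ_i + j - i}^{(i-1)})_{1 ≤ i, j ≤ ℓ}` (the row with 1-based number `i` is the row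
`i - 1` here). -/
def g {ℓ : ℕ} (γ : Fin ℓ → ℤ) : SymAmbient :=
  (Matrix.of fun i j : Fin ℓ => kh (i : ℕ) (γ i + (j : ℤ) - (i : ℤ))).det

/-! ### Operators on subscripts

A series `∑_γ c_γ x^γ` stands for the formal combination `∑_γ c_γ g_γ`.  Raising and lowering
operators act on subscripts, that is, on the exponents `γ`; after all operators have acted, `x^γ` is
replaced by `g_γ`. -/

/-- Formal combinations of subscripts `γ ∈ ℤ^ℓ`, possibly infinite, with well-ordered support in the
lexicographic order.  This is a commutative ring. -/
abbrev Subscripts (ℓ : ℕ) : Type := HahnSeries (Lex (Fin ℓ → ℤ)) ℤ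

/-- The formal symbol `x^γ` with subscript `γ`. -/
def mono {ℓ : ℕ} (γ : Fin ℓ → ℤ) : Subscripts ℓ := HahnSeries.single (toLex γ) 1

/-- The sequence `ε_i` with a `1` in position `i` and `0` elsewhere. -/
def eps {ℓ : ℕ} (i : Fin ℓ) : Fin ℓ → ℤ := Pi.single i 1

/-- The lowering operator `L_z`, `x^γ ↦ x^{γ - ε_z}`, as multiplication by `x^{-ε_z}`. -/
def lowering {ℓ : ℕ} (z : Fin ℓ) : Subscripts ℓ := mono (-eps z)

/-- The raising operator `R_{ij}`, `x^γ ↦ x^{γ + ε_i - ε_j}`, as multiplication by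
`x^{ε_i - ε_j}`. -/
def raising {ℓ : ℕ} (i j : Fin ℓ) : Subscripts ℓ := mono (eps i - eps j)

/-- Replace every `x^γ` by `g_γ`. -/
def toSym {ℓ : ℕ} (F : Subscripts ℓ) : SymAmbient :=
  ∑ᶠ γ : Fin ℓ → ℤ, F.coeff (toLex γ) • g γ

/-- The operator expression `∏_{z ∈ M} (1 - L_z) ∏_{(i,j) ∈ Ψ} (1 - R_{ij})⁻¹` applied to the
subscript `γ`. -/
def katalanSeries {ℓ : ℕ} (Ψ : Finset (Fin ℓ × Fin ℓ)) (M : Multiset (Fin ℓ)) (γ : Fin ℓ → ℤ) :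
    Subscripts ℓ :=
  (M.map fun z => 1 - lowering z).prod *
    (∏ p ∈ Ψ, Ring.inverse (1 - raising p.1 p.2)) * mono γ

/-! ### Root ideals -/

/-- `Δ⁺_ℓ = {(i, j) | i < j}`. -/
def posRoots (ℓ : ℕ) : Finset (Fin ℓ × Fin ℓ) := Finset.univ.filter fun p => p.1 < p.2

/-- A root ideal: an upper order ideal of `Δ⁺_ℓ`, where `(a, b) ≤ (c, d)` iff `a ≥ c` and
`b ≤ d`. -/
def IsRootIdeal {ℓ : ℕ} (Ψ : Finset (Fin ℓ × Fin ℓ)) : Prop :=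
  Ψ ⊆ posRoots ℓ ∧
    ∀ p ∈ Ψ, ∀ q ∈ posRoots ℓ, q.1 ≤ p.1 → p.2 ≤ q.2 → q ∈ Ψ

/-- A root of `Ψ` is removable if deleting it leaves a root ideal. -/
def IsRemovable {ℓ : ℕ} (Ψ : Finset (Fin ℓ × Fin ℓ)) (α : Fin ℓ × Fin ℓ) : Prop :=
  α ∈ Ψ ∧ IsRootIdeal (Ψ.erase α)

open Classical in
/-- `down_Ψ(x)`: the `j` such that `(x, j)` is removable in `Ψ`, and undefined (`none`) if there is
no such `j`. -/
def down {ℓ : ℕ} (Ψ : Finset (Fin ℓ × Fin ℓ)) (x : Fin ℓ) : Option (Fin ℓ) :=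
  if hx : ∃ j, IsRemovable Ψ (x, j) then some hx.choose else none

/-- The iterate `down_Ψ^a(x)`, where `down_Ψ^0(x) = x`. -/
def downIter {ℓ : ℕ} (Ψ : Finset (Fin ℓ × Fin ℓ)) (a : ℕ) (x : Fin ℓ) : Option (Fin ℓ) :=
  (fun o : Option (Fin ℓ) => o.bind (down Ψ))^[a] (some x)

/-- The bottom of a root ideal: the (1-based) number of the last nonempty row, and `0` if the root
ideal is empty. -/
def bottom {ℓ : ℕ} (Ψ : Finset (Fin ℓ × Fin ℓ)) : ℕ := Ψ.sup fun p => (p.1 : ℕ) + 1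

/-- The multiset `L(Ψ)` of second components of elements of `Ψ`. -/
def colMultiset {ℓ : ℕ} (Ψ : Finset (Fin ℓ × Fin ℓ)) : Multiset (Fin ℓ) := Ψ.val.map Prod.snd

/-- The Katalan function `K(Ψ; M; γ)`. -/
def katalan {ℓ : ℕ} (Ψ : Finset (Fin ℓ × Fin ℓ)) (M : Multiset (Fin ℓ)) (γ : Fin ℓ → ℤ) :
    SymAmbient := toSym (katalanSeries Ψ M γ)

/-! ### Weighted `K`-`k`-Schur functions -/

/-- `P^k_ℓ`: sequences `k ≥ λ_1 ≥ ⋯ ≥ λ_ℓ ≥ 0` of integers. -/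
def IsBddPartition {ℓ : ℕ} (k : ℕ) (lam : Fin ℓ → ℤ) : Prop :=
  Antitone lam ∧ ∀ i, 0 ≤ lam i ∧ lam i ≤ k

/-- `Δ^k(λ) = {(i, j) ∈ Δ⁺_ℓ | k - λ_i + i < j}`. -/
def deltaK {ℓ : ℕ} (k : ℕ) (lam : Fin ℓ → ℤ) : Finset (Fin ℓ × Fin ℓ) :=
  (posRoots ℓ).filter fun p => (k : ℤ) - lam p.1 + (p.1 : ℤ) < (p.2 : ℤ)

open Classical in
/-- The set `{down_λ(x) | x ∈ [z, b_λ]}`. -/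
def downSet {ℓ : ℕ} (k : ℕ) (lam : Fin ℓ → ℤ) (z : Fin ℓ) : Finset (Fin ℓ) :=
  Finset.univ.filter fun j => ∃ x : Fin ℓ, z ≤ x ∧ (x : ℕ) + 1 ≤ bottom (deltaK k lam) ∧
    down (deltaK k lam) x = some j

/-- The multiset `L(Δ^k(λ)) ∖ {down_λ(x) | x ∈ [z, b_λ]}`. -/
def weightMultiset {ℓ : ℕ} (k : ℕ) (lam : Fin ℓ → ℤ) (z : Fin ℓ) : Multiset (Fin ℓ) :=
  colMultiset (deltaK k lam) - (downSet k lam z).val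

/-- The operator expression (acting on the subscript `λ`) that defines the `K`-`k`-Schur function of
weight `z`. -/
def weightedSeries {ℓ : ℕ} (k : ℕ) (lam : Fin ℓ → ℤ) (z : Fin ℓ) : Subscripts ℓ :=
  katalanSeries (deltaK k lam) (weightMultiset k lam z) lam

/-- The `K`-`k`-Schur function of weight `z`, which is
`K(Δ^k(λ); L(Δ^k(λ)) ∖ {down_λ(x) | x ∈ [z, b_λ]}; λ)`. -/
def weightedKkSchur {ℓ : ℕ} (k : ℕ) (lam : Fin ℓ → ℤ) (z : Fin ℓ) : SymAmbient :=
  katalan (deltaK k lam) (weightMultiset k lam z) lam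

/-- `L_d` applied to the `K`-`k`-Schur function of weight `z`: the operator acts on subscripts. -/
def loweringWeighted {ℓ : ℕ} (k : ℕ) (d : Fin ℓ) (lam : Fin ℓ → ℤ) (z : Fin ℓ) : SymAmbient :=
  toSym (lowering d * weightedSeries k lam z)

/-! ### The definitions make sense: `1 - R_{ij}` is invertible with inverse the geometric series, and
the sum in `toSym` is finite for every Katalan function -/

theorem orderTop_raising_pos {ℓ : ℕ} {i j : Fin ℓ} (hij : i < j) :
    0 < (raising i j).orderTop := by
  rw [raising, mono, HahnSeries.orderTop_single one_ne_zero]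
  norm_cast
  refine ⟨i, fun m hm => ?_, ?_⟩
  · have h1 : m ≠ i := ne_of_lt hm
    have h2 : m ≠ j := ne_of_lt (lt_trans hm hij)
    change (0 : ℤ) = eps i m - eps j m
    simp [eps, h1, h2]
  · change (0 : ℤ) < eps i i - eps j i
    simp [eps, hij.ne]

theorem one_sub_raising_mul {ℓ : ℕ} {i j : Fin ℓ} (hij : i < j) :
    (1 - raising i j) * (SummableFamily.powers (raising i j)).hsum = 1 :=
  SummableFamily.one_sub_self_mul_hsum_powers (orderTop_raising_pos hij)

theorem inverse_one_sub_raising {ℓ : ℕ} {i j : Fin ℓ} (hij : i < j) :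
    Ring.inverse (1 - raising i j) = (SummableFamily.powers (raising i j)).hsum := by
  have h1 := one_sub_raising_mul hij
  have hu : IsUnit (1 - raising i j) := .of_mul_eq_one _ h1
  calc Ring.inverse (1 - raising i j)
      = Ring.inverse (1 - raising i j) *
          ((1 - raising i j) * (SummableFamily.powers (raising i j)).hsum) := by rw [h1, mul_one]
    _ = _ := by rw [← mul_assoc, Ring.inverse_mul_cancel _ hu, one_mul]

theorem raising_pow {ℓ : ℕ} (i j : Fin ℓ) (n : ℕ) :
    raising i j ^ n = mono (n • (eps i - eps j)) := by
  simp [raising, mono, HahnSeries.single_pow]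

/-- All tail sums of the subscripts in `F` are bounded above. -/
def TailBounded {ℓ : ℕ} (F : Subscripts ℓ) : Prop :=
  ∃ C : ℤ, ∀ δ : Fin ℓ → ℤ, F.coeff (toLex δ) ≠ 0 → ∀ m : Fin ℓ, ∑ i ∈ Finset.Ici m, δ i ≤ C

theorem tailBounded_mono {ℓ : ℕ} (γ : Fin ℓ → ℤ) : TailBounded (mono γ) := by
  refine ⟨∑ m, |∑ i ∈ Finset.Ici m, γ i|, fun δ hδ m => ?_⟩
  have : δ = γ := by
    by_contra hne
    exact hδ (HahnSeries.coeff_single_of_ne fun h => hne (toLex.injective h))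
  subst this
  exact (le_abs_self _).trans
    (Finset.single_le_sum (f := fun m => |∑ i ∈ Finset.Ici m, δ i|) (fun _ _ => abs_nonneg _)
      (Finset.mem_univ m))

theorem tailBounded_sub {ℓ : ℕ} {F G : Subscripts ℓ} (hF : TailBounded F) (hG : TailBounded G) :
    TailBounded (F - G) := by
  obtain ⟨C, hC⟩ := hF
  obtain ⟨D, hD⟩ := hG
  refine ⟨max C D, fun δ hδ m => ?_⟩
  by_cases h1 : F.coeff (toLex δ) = 0
  · have h2 : G.coeff (toLex δ) ≠ 0 := by
      intro h2; exact hδ (by simp [h1, h2])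
    exact (hD δ h2 m).trans (le_max_right _ _)
  · exact (hC δ h1 m).trans (le_max_left _ _)

theorem tailBounded_mul {ℓ : ℕ} {F G : Subscripts ℓ} (hF : TailBounded F) (hG : TailBounded G) :
    TailBounded (F * G) := by
  obtain ⟨C, hC⟩ := hF
  obtain ⟨D, hD⟩ := hG
  refine ⟨C + D, fun δ hδ m => ?_⟩
  obtain ⟨a, ha, b, hb, hab⟩ := HahnSeries.support_mul_subset (HahnSeries.mem_support _ _ |>.2 hδ)
  have h1 := hC (ofLex a) ha m
  have h2 := hD (ofLex b) hb m
  have : δ = ofLex a + ofLex b := toLex.injective hab.symm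
  rw [this]
  simp only [Pi.add_apply, Finset.sum_add_distrib]
  linarith

theorem tailBounded_one {ℓ : ℕ} : TailBounded (1 : Subscripts ℓ) :=
  tailBounded_mono 0

theorem tailBounded_inverse {ℓ : ℕ} {i j : Fin ℓ} (hij : i < j) :
    TailBounded (Ring.inverse (1 - raising i j)) := by
  rw [inverse_one_sub_raising hij]
  refine ⟨0, fun δ hδ m => ?_⟩
  rw [SummableFamily.coeff_hsum] at hδ
  obtain ⟨n, hn⟩ : ∃ n, ((SummableFamily.powers (raising i j)) n).coeff (toLex δ) ≠ 0 := by
    by_contra! hall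
    exact hδ (by simp only [hall, finsum_zero])
  rw [SummableFamily.coe_powers (orderTop_raising_pos hij), raising_pow] at hn
  have : δ = n • (eps i - eps j) := by
    by_contra hne
    exact hn (HahnSeries.coeff_single_of_ne fun h => hne (toLex.injective h))
  subst this
  have hs : ∀ l : Fin ℓ, ∑ x ∈ Finset.Ici m, eps l x = if m ≤ l then 1 else 0 := by
    intro l
    simp [eps, Pi.single_apply]
  simp only [Pi.smul_apply, Pi.sub_apply, ← Finset.smul_sum, Finset.sum_sub_distrib, hs]
  have : (if m ≤ i then (1 : ℤ) else 0) - (if m ≤ j then 1 else 0) ≤ 0 := by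
    split_ifs with h1 h2
    · simp
    · exact absurd (h1.trans hij.le) h2
    · simp
    · simp
  simpa using mul_nonpos_of_nonneg_of_nonpos (Int.natCast_nonneg n) this

theorem tailBounded_katalanSeries {ℓ : ℕ} {Ψ : Finset (Fin ℓ × Fin ℓ)} (hΨ : Ψ ⊆ posRoots ℓ)
    (M : Multiset (Fin ℓ)) (γ : Fin ℓ → ℤ) : TailBounded (katalanSeries Ψ M γ) := by
  refine tailBounded_mul (tailBounded_mul ?_ ?_) (tailBounded_mono γ)
  · induction M using Multiset.induction_on with
    | empty => simpa using tailBounded_one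
    | cons a s ih =>
      simp only [Multiset.map_cons, Multiset.prod_cons]
      exact tailBounded_mul (tailBounded_sub tailBounded_one (tailBounded_mono _)) ih
  · refine Finset.prod_induction _ TailBounded (fun _ _ => tailBounded_mul) tailBounded_one ?_
    intro p hp
    exact tailBounded_inverse (by simpa [posRoots] using hΨ hp)

theorem g_eq_zero {ℓ : ℕ} {γ : Fin ℓ → ℤ} {i : Fin ℓ} (hi : γ i < -ℓ) : g γ = 0 := by
  refine Matrix.det_eq_zero_of_row_eq_zero i fun j => ?_
  have hj := j.2
  have : γ i + (j : ℤ) - (i : ℤ) < 0 := by omega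
  exact if_pos this

/-- The sum in `toSym` has only finitely many nonzero terms. -/
theorem finite_support_toSym {ℓ : ℕ} {F : Subscripts ℓ} (hF : TailBounded F) :
    (Function.support fun γ : Fin ℓ → ℤ => F.coeff (toLex γ) • g γ).Finite := by
  obtain ⟨C, hC⟩ := hF
  refine (Set.finite_Icc (fun _ : Fin ℓ => -(ℓ : ℤ)) (fun _ => C + ℓ * ℓ)).subset ?_
  intro γ hγ
  have h1 : F.coeff (toLex γ) ≠ 0 := fun h => hγ (by simp [h])
  have h2 : ∀ i, -(ℓ : ℤ) ≤ γ i := by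
    intro i
    by_contra hi
    exact hγ (by simp [g_eq_zero (not_le.1 hi)])
  refine ⟨h2, fun m => ?_⟩
  have h3 := hC γ h1 m
  have hmem : m ∈ Finset.Ici m := by simp
  rw [← Finset.add_sum_erase _ _ hmem] at h3
  have h4 : -(ℓ * ℓ : ℤ) ≤ ∑ i ∈ (Finset.Ici m).erase m, γ i := by
    have h5 := Finset.card_nsmul_le_sum ((Finset.Ici m).erase m) γ (-(ℓ : ℤ)) fun i _ => h2 i
    have h6 : ((Finset.Ici m).erase m).card ≤ ℓ := by
      simpa using Finset.card_le_univ ((Finset.Ici m).erase m)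
    have h7 : (((Finset.Ici m).erase m).card : ℤ) * ℓ ≤ ℓ * ℓ := by gcongr
    rw [nsmul_eq_mul] at h5
    linarith
  show γ m ≤ C + ℓ * ℓ
  linarith

end KKSchur

end

open KKSchur

/-!
Part 1 holds because row `d` of `Δ^k(λ)` is empty: lowering `λ_d` changes neither the root ideal nor
the multiset of lowering operators, and `L_d` just shifts the subscript.

Part 2 is clear if `d = ℓ`, where `λ_ℓ = 0`: the operators never raise the last entry of a subscript,
and `g_γ` has a zero row if `γ_ℓ < 0`. Otherwise `λ_d = λ_{d+1}`, and the vanishing is a straightening.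
By Pascal's rule (`kh_succ_sub`), `1 - L_{y+1}` turns `g_γ` into a determinant whose rows `y`, `y + 1`
come from the same family `k^{(y-1)}`, hence into a function that is anti-invariant under
`(…, γ_y, γ_{y+1}, …) ↦ (…, γ_{y+1} - 1, γ_y + 1, …)` (`gEqualRows_dotSwap`). So a Katalan function
vanishes if its roots are symmetric in `y`, `y + 1`, if `y + 1` occurs once more than `y` in the
multiset, and if `γ_{y+1} = γ_y + 1` (`katalan_eq_zero_of_swap`). The exchange of two entries does not
respect the order of the Hahn series, so symmetry is expressed by the relation `PermRel` on
coefficients, which is compatible with products.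

For the weighted functions, the multiplicities are right at every `y = down c` with `c ≥ z`
(`count_weightMultiset_succ`). If `y + 1` is not the first column of a row, the roots are symmetric
too. Otherwise `y + 1 = down (c + 1)` and `λ_c = λ_{c+1}`; the one unsymmetric root `(c + 1, y + 1)`
can be traded for the pair `(c + 1, y)`, `(c + 1, y + 1)` while the subscript gains
`ε_{c+1} - ε_{y+1}` (`katalan_insert_eq`). This makes rows `c`, `c + 1` of the root set equal and gives
`γ_{c+1} = γ_c + 1`, so that the same problem is met at `c`, one step up the bounce path
(`katalan_eq_zero_of_downIter`). The descent `λ_z > λ_{z+1}` ends the process at `z` at the latest.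
-/

namespace KKSchur

/-! ### Straightening of the determinants `g_γ` -/

theorem kh_of_neg (r : ℕ) {m : ℤ} (hm : m < 0) : kh r m = 0 := if_pos hm

/-- Pascal's rule: `(1 - L) k^{(r+1)} = k^{(r)}`. -/
theorem kh_succ_sub (r : ℕ) (m : ℤ) : kh (r + 1) m - kh (r + 1) (m - 1) = kh r m := by
  rcases lt_or_ge m 0 with hm | hm
  · rw [kh_of_neg _ hm, kh_of_neg _ hm, kh_of_neg _ (by omega), sub_zero]
  obtain ⟨n, rfl⟩ := Int.eq_ofNat_of_zero_le hm
  cases n with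
  | zero => simp [kh]
  | succ n =>
    have h1 : ((n + 1 : ℕ) : ℤ) - 1 = n := by push_cast; ring
    have h2 : ¬ (((n + 1 : ℕ) : ℤ) < 0) := by omega
    have h3 : ¬ ((n : ℤ) < 0) := by omega
    rw [h1]
    simp only [kh, h2, h3, if_false, Int.toNat_natCast]
    rw [Finset.sum_range_succ' _ (n + 1), Finset.sum_range_succ' _ (n + 1),
      add_sub_right_comm, ← Finset.sum_sub_distrib]
    refine congrArg₂ (· + ·) (Finset.sum_congr rfl fun i _ => ?_) (by simp)
    have h4 : (r + 1 + (i + 1) - 1).choose (i + 1) =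
        (r + 1 + i - 1).choose i + (r + (i + 1) - 1).choose (i + 1) := by
      rw [show r + 1 + (i + 1) - 1 = (r + i) + 1 by omega, show r + 1 + i - 1 = r + i by omega,
        show r + (i + 1) - 1 = r + i by omega, Nat.choose_succ_succ]
    rw [h4, show n + 1 - (i + 1) = n - i by omega]
    push_cast
    ring

/-- The determinant `g_γ` with the row `y'` taken from `k^{(y)}` instead of `k^{(y')}`; for
`y' = y + 1` this is the value of `1 - L_{y'}` on `g_γ`. -/
noncomputable def gEqualRows {ℓ : ℕ} (y y' : Fin ℓ) (γ : Fin ℓ → ℤ) : SymAmbient :=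
  (Matrix.of fun i j : Fin ℓ =>
    kh (if i = y' then (y : ℕ) else i) (γ i + (j : ℤ) - (i : ℤ))).det

theorem g_sub_g_sub_eps {ℓ : ℕ} {y y' : Fin ℓ} (hy : (y' : ℕ) = y + 1) (γ : Fin ℓ → ℤ) :
    g γ - g (γ - eps y') = gEqualRows y y' γ := by
  rw [sub_eq_iff_eq_add', g, g, gEqualRows]
  set A : Matrix (Fin ℓ) (Fin ℓ) SymAmbient :=
    Matrix.of fun i j : Fin ℓ => kh (i : ℕ) (γ i + (j : ℤ) - (i : ℤ))
  set u : Fin ℓ → SymAmbient := fun j => kh (y' : ℕ) (γ y' + (j : ℤ) - (y' : ℤ) - 1)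
  set v : Fin ℓ → SymAmbient := fun j => kh (y : ℕ) (γ y' + (j : ℤ) - (y' : ℤ))
  have h1 : A = A.updateRow y' (u + v) := by
    ext1 i j
    by_cases hi : i = y'
    · subst hi
      simp only [Matrix.updateRow_self, Pi.add_apply, A, u, v, Matrix.of_apply]
      rw [← kh_succ_sub (y : ℕ), ← hy]
      ring
    · rw [Matrix.updateRow_ne hi]
  have h2 : (Matrix.of fun i j : Fin ℓ =>
      kh (i : ℕ) ((γ - eps y') i + (j : ℤ) - (i : ℤ))) = A.updateRow y' u := by
    ext1 i j
    by_cases hi : i = y'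
    · subst hi
      simp only [Matrix.updateRow_self, u, Matrix.of_apply, Pi.sub_apply, eps, Pi.single_eq_same]
      congr 1; ring
    · rw [Matrix.updateRow_ne hi]
      simp [A, eps, hi]
  have h3 : (Matrix.of fun i j : Fin ℓ =>
      kh (if i = y' then (y : ℕ) else i) (γ i + (j : ℤ) - (i : ℤ))) = A.updateRow y' v := by
    ext1 i j
    by_cases hi : i = y'
    · subst hi
      simp [v]
    · rw [Matrix.updateRow_ne hi]
      simp [A, hi]
  rw [h2, h3, ← Matrix.det_updateRow_add, ← h1]

/-- The dot action of the transposition of `y` and `y'`: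
`(…, a, b, …) ↦ (…, b - 1, a + 1, …)`. -/
def dotSwap {ℓ : ℕ} (y y' : Fin ℓ) (δ : Fin ℓ → ℤ) : Fin ℓ → ℤ :=
  (fun i => δ (Equiv.swap y y' i)) - eps y + eps y'

theorem dotSwap_left {ℓ : ℕ} {y y' : Fin ℓ} (hne : y ≠ y') (δ : Fin ℓ → ℤ) :
    dotSwap y y' δ y = δ y' - 1 := by
  simp [dotSwap, eps, hne]

theorem dotSwap_right {ℓ : ℕ} {y y' : Fin ℓ} (hne : y ≠ y') (δ : Fin ℓ → ℤ) :
    dotSwap y y' δ y' = δ y + 1 := by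
  simp [dotSwap, eps, hne.symm]

theorem dotSwap_of_ne {ℓ : ℕ} {y y' i : Fin ℓ} (h1 : i ≠ y) (h2 : i ≠ y') (δ : Fin ℓ → ℤ) :
    dotSwap y y' δ i = δ i := by
  simp [dotSwap, eps, h1, h2, Equiv.swap_apply_of_ne_of_ne h1 h2]

theorem dotSwap_involutive {ℓ : ℕ} {y y' : Fin ℓ} (hne : y ≠ y') :
    Function.Involutive (dotSwap y y') := by
  intro δ
  ext i
  by_cases h1 : i = y
  · subst h1
    rw [dotSwap_left hne, dotSwap_right hne]; ring
  by_cases h2 : i = y'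
  · subst h2
    rw [dotSwap_right hne, dotSwap_left hne]; ring
  rw [dotSwap_of_ne h1 h2, dotSwap_of_ne h1 h2]

theorem gEqualRows_dotSwap {ℓ : ℕ} {y y' : Fin ℓ} (hy : (y' : ℕ) = y + 1) (γ : Fin ℓ → ℤ) :
    gEqualRows y y' (dotSwap y y' γ) = -gEqualRows y y' γ := by
  have hne : y ≠ y' := fun h => by rw [h] at hy; omega
  have hyz : (y' : ℤ) = y + 1 := by exact_mod_cast hy
  have h1 := Matrix.det_permute (Equiv.swap y y') (Matrix.of fun i j : Fin ℓ =>
    kh (if i = y' then (y : ℕ) else i) (γ i + (j : ℤ) - (i : ℤ)))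
  rw [Equiv.Perm.sign_swap hne] at h1
  rw [gEqualRows, gEqualRows]
  refine Eq.trans (congrArg _ ?_) (h1.trans (by simp))
  ext1 i j
  by_cases h2 : i = y
  · subst h2
    simp only [Matrix.of_apply, Matrix.submatrix_apply, Equiv.swap_apply_left, id,
      dotSwap_left hne, if_neg hne, if_true]
    congr 1; linarith
  by_cases h3 : i = y'
  · subst h3
    simp only [Matrix.of_apply, Matrix.submatrix_apply, Equiv.swap_apply_right, id,
      dotSwap_right hne, if_neg hne, if_true]
    congr 1; linarith
  simp only [Matrix.of_apply, Matrix.submatrix_apply, Equiv.swap_apply_of_ne_of_ne h2 h3, id,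
      dotSwap_of_ne h2 h3]

/-! ### Linearity of `toSym`, and the straightening of subscripts -/

theorem toSym_sub {ℓ : ℕ} {F G : Subscripts ℓ} (hF : TailBounded F) (hG : TailBounded G) :
    toSym (F - G) = toSym F - toSym G := by
  rw [toSym, toSym, toSym,
    ← finsum_sub_distrib (finite_support_toSym hF) (finite_support_toSym hG)]
  exact finsum_congr fun γ => by rw [HahnSeries.coeff_sub, sub_smul]

theorem tailBounded_lowering {ℓ : ℕ} (z : Fin ℓ) : TailBounded (lowering z) := tailBounded_mono _

theorem coeff_mono_mul {ℓ : ℕ} (γ δ : Fin ℓ → ℤ) (F : Subscripts ℓ) :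
    (mono γ * F).coeff (toLex δ) = F.coeff (toLex (δ - γ)) := by
  rw [mono, HahnSeries.coeff_single_mul, one_mul]
  rfl

theorem toSym_mono_mul {ℓ : ℕ} (γ : Fin ℓ → ℤ) (F : Subscripts ℓ) :
    toSym (mono γ * F) = ∑ᶠ δ : Fin ℓ → ℤ, F.coeff (toLex δ) • g (δ + γ) := by
  rw [toSym, ← finsum_comp_equiv (Equiv.addRight γ)]
  refine finsum_congr fun δ => ?_
  rw [coeff_mono_mul]
  simp

theorem toSym_one_sub_lowering_mul {ℓ : ℕ} {y y' : Fin ℓ} (hy : (y' : ℕ) = y + 1)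
    {F : Subscripts ℓ} (hF : TailBounded F) :
    toSym ((1 - lowering y') * F) =
      ∑ᶠ δ : Fin ℓ → ℤ, F.coeff (toLex δ) • gEqualRows y y' δ := by
  have h1 : TailBounded (lowering y' * F) := tailBounded_mul (tailBounded_lowering _) hF
  have h2 : (Function.support fun δ : Fin ℓ → ℤ => F.coeff (toLex δ) • g (δ - eps y')).Finite := by
    have h3 := (finite_support_toSym h1).preimage
      (Equiv.addRight (-eps y')).injective.injOn
    refine h3.subset fun δ hδ => ?_
    simp only [Set.mem_preimage, Function.mem_support, lowering, coeff_mono_mul] at hδ ⊢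
    simpa [← sub_eq_add_neg] using hδ
  rw [sub_mul, one_mul, toSym_sub hF h1, lowering, toSym_mono_mul, toSym]
  simp only [← sub_eq_add_neg]
  rw [← finsum_sub_distrib (finite_support_toSym hF) h2]
  exact finsum_congr fun δ => by rw [← smul_sub, g_sub_g_sub_eps hy]

/-- A combination whose coefficients are invariant under the dot action is killed by `1 - L_{y+1}`
followed by evaluation, because the `gEqualRows` are anti-invariant. -/
theorem toSym_eq_zero_of_dotSwap {ℓ : ℕ} {y y' : Fin ℓ} (hy : (y' : ℕ) = y + 1)
    {F : Subscripts ℓ} (hF : TailBounded F)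
    (hsymm : ∀ δ, F.coeff (toLex (dotSwap y y' δ)) = F.coeff (toLex δ)) :
    toSym ((1 - lowering y') * F) = 0 := by
  have hne : y ≠ y' := fun h => by rw [h] at hy; omega
  rw [toSym_one_sub_lowering_mul hy hF]
  set S := ∑ᶠ δ : Fin ℓ → ℤ, F.coeff (toLex δ) • gEqualRows y y' δ with hS
  have h1 : S = -S := by
    conv_lhs => rw [hS, ← finsum_comp_equiv (dotSwap_involutive hne).toPerm]
    rw [hS, ← finsum_neg_distrib]
    refine finsum_congr fun δ => ?_
    rw [Function.Involutive.coe_toPerm, hsymm, gEqualRows_dotSwap hy, smul_neg]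
  have h2 : (2 : ℤ) • S = 0 := by rw [two_smul]; exact eq_neg_iff_add_eq_zero.1 h1
  ext m
  have h3 : (2 : ℤ) • MvPowerSeries.coeff m S = 0 := by
    rw [← map_zsmul, h2, map_zero]
  simpa using h3

/-! ### Permuting the entries of subscripts -/

/-- `G` arises from `F` by permuting the entries of all subscripts by `σ`. -/
def PermRel {ℓ : ℕ} (σ : Equiv.Perm (Fin ℓ)) (F G : Subscripts ℓ) : Prop :=
  ∀ δ : Fin ℓ → ℤ, G.coeff (toLex fun i => δ (σ i)) = F.coeff (toLex δ)

namespace PermRel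

variable {ℓ : ℕ} {σ : Equiv.Perm (Fin ℓ)} {F G F' G' : Subscripts ℓ}

theorem mul (h : PermRel σ F G) (h' : PermRel σ F' G') : PermRel σ (F * F') (G * G') := by
  intro δ
  rw [HahnSeries.coeff_mul, HahnSeries.coeff_mul]
  symm
  refine Finset.sum_nbij' (fun p => (toLex fun i => ofLex p.1 (σ i), toLex fun i => ofLex p.2 (σ i)))
    (fun p => (toLex fun i => ofLex p.1 (σ.symm i), toLex fun i => ofLex p.2 (σ.symm i)))
    ?_ ?_ ?_ ?_ ?_
  · rintro ⟨a, b⟩ hab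
    simp only [Finset.mem_antidiagonal, HahnSeries.mem_support] at hab ⊢
    obtain ⟨ha, hb, hab⟩ := hab
    refine ⟨?_, ?_, ?_⟩
    · rw [h (ofLex a)]; exact ha
    · rw [h' (ofLex b)]; exact hb
    · have h1 : δ = ofLex a + ofLex b := toLex.injective hab.symm
      rw [h1]; rfl
  · rintro ⟨a, b⟩ hab
    simp only [Finset.mem_antidiagonal, HahnSeries.mem_support] at hab ⊢
    obtain ⟨ha, hb, hab⟩ := hab
    refine ⟨?_, ?_, ?_⟩
    · rw [← h]; simp only [Equiv.symm_apply_apply]; exact ha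
    · rw [← h']; simp only [Equiv.symm_apply_apply]; exact hb
    · have h1 : (fun i => δ (σ i)) = ofLex a + ofLex b := toLex.injective hab.symm
      refine congrArg toLex (funext fun i => ?_)
      have h2 := congrFun h1 (σ.symm i)
      simpa using h2.symm
  · rintro ⟨a, b⟩ _
    simp only [ofLex_toLex, Equiv.apply_symm_apply]
    rfl
  · rintro ⟨a, b⟩ _
    simp only [ofLex_toLex, Equiv.symm_apply_apply]
    rfl
  · rintro ⟨a, b⟩ _
    rw [h (ofLex a), h' (ofLex b)]
    rfl

theorem sub (h : PermRel σ F G) (h' : PermRel σ F' G') : PermRel σ (F - F') (G - G') := by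
  intro δ
  rw [HahnSeries.coeff_sub, HahnSeries.coeff_sub, h, h']

theorem mono {γ γ' : Fin ℓ → ℤ} (hγ : ∀ i, γ' i = γ (σ i)) :
    PermRel σ (KKSchur.mono γ) (KKSchur.mono γ') := by
  intro δ
  have hγ' : γ' = fun i => γ (σ i) := funext hγ
  simp only [KKSchur.mono, HahnSeries.coeff_single, toLex_inj]
  refine if_congr ⟨fun h1 => ?_, fun h1 => ?_⟩ rfl rfl
  · ext i
    have := congrFun h1 (σ.symm i)
    rw [hγ] at this
    simpa using this
  · rw [h1, hγ']

theorem one : PermRel σ (1 : Subscripts ℓ) 1 := mono (γ := 0) (γ' := 0) fun _ => rfl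

theorem prod {ι : Type*} (s : Finset ι) {f f' : ι → Subscripts ℓ}
    (h : ∀ i ∈ s, PermRel σ (f i) (f' i)) : PermRel σ (∏ i ∈ s, f i) (∏ i ∈ s, f' i) := by
  classical
  induction s using Finset.induction_on with
  | empty => simpa using one
  | insert a s ha ih =>
    rw [Finset.prod_insert ha, Finset.prod_insert ha]
    exact (h a (Finset.mem_insert_self _ _)).mul
      (ih fun i hi => h i (Finset.mem_insert_of_mem hi))

theorem multiset_prod {ι : Type*} (s : Multiset ι) {f f' : ι → Subscripts ℓ}
    (h : ∀ i ∈ s, PermRel σ (f i) (f' i)) : PermRel σ (s.map f).prod (s.map f').prod := by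
  induction s using Multiset.induction_on with
  | empty => simpa using one
  | cons a s ih =>
    simp only [Multiset.map_cons, Multiset.prod_cons]
    exact (h a (Multiset.mem_cons_self _ _)).mul
      (ih fun i hi => h i (Multiset.mem_cons_of_mem hi))

theorem eps_apply (i j : Fin ℓ) : eps (σ.symm i) j = eps i (σ j) := by
  simp only [eps, Pi.single_apply, Equiv.eq_symm_apply]

theorem lowering (i : Fin ℓ) : PermRel σ (lowering i) (KKSchur.lowering (σ.symm i)) :=
  mono fun j => by simp [eps_apply]

theorem inverse_one_sub_raising {i j : Fin ℓ} (hij : i < j) (hij' : σ.symm i < σ.symm j) :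
    PermRel σ (Ring.inverse (1 - raising i j))
      (Ring.inverse (1 - raising (σ.symm i) (σ.symm j))) := by
  intro δ
  rw [KKSchur.inverse_one_sub_raising hij, KKSchur.inverse_one_sub_raising hij',
    HahnSeries.SummableFamily.coeff_hsum, HahnSeries.SummableFamily.coeff_hsum]
  refine finsum_congr fun n => ?_
  rw [HahnSeries.SummableFamily.coe_powers (orderTop_raising_pos hij),
    HahnSeries.SummableFamily.coe_powers (orderTop_raising_pos hij'), raising_pow, raising_pow]
  refine mono (fun l => ?_) δ
  simp [eps_apply]

end PermRel

/-! ### Straightening and root expansion for Katalan functions -/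

theorem mono_mul_mono {ℓ : ℕ} (γ δ : Fin ℓ → ℤ) : mono γ * mono δ = mono (γ + δ) := by
  rw [mono, mono, HahnSeries.single_mul_single, one_mul]
  rfl

theorem lowering_mul_katalanSeries {ℓ : ℕ} (Ψ : Finset (Fin ℓ × Fin ℓ)) (M : Multiset (Fin ℓ))
    (γ : Fin ℓ → ℤ) (d : Fin ℓ) :
    lowering d * katalanSeries Ψ M γ = katalanSeries Ψ M (γ - eps d) := by
  rw [katalanSeries, katalanSeries, mul_left_comm, lowering, mono_mul_mono, neg_add_eq_sub]

/-- If the roots are stable under exchanging `y` and `y + 1`, the subscript is fixed by the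
corresponding dot action, and `y + 1` occurs once more than `y` among the lowering operators, then
the Katalan function vanishes: setting one factor `1 - L_{y+1}` aside leaves a combination that is
invariant under the dot action. -/
theorem katalan_eq_zero_of_swap {ℓ : ℕ} {y y' : Fin ℓ} (hy : (y' : ℕ) = y + 1)
    {Ψ : Finset (Fin ℓ × Fin ℓ)} (hΨ : Ψ ⊆ posRoots ℓ)
    (hsymm : ∀ p ∈ Ψ, (Equiv.swap y y' p.1, Equiv.swap y y' p.2) ∈ Ψ)
    {M : Multiset (Fin ℓ)} (hM : M.count y' = M.count y + 1)
    {γ : Fin ℓ → ℤ} (hγ : γ y' = γ y + 1) : katalan Ψ M γ = 0 := by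
  have hne : y ≠ y' := fun h => by rw [h] at hy; omega
  have hlt : ∀ p ∈ Ψ, p.1 < p.2 := fun p hp => by simpa [posRoots] using hΨ hp
  obtain ⟨N, rfl⟩ := Multiset.exists_cons_of_mem (Multiset.count_pos.1 (by omega : 0 < M.count y'))
  have hN : N.count y' = N.count y := by
    rw [Multiset.count_cons_self, Multiset.count_cons_of_ne hne] at hM
    omega
  have hNσ : N.map (Equiv.swap y y') = N := by
    ext i
    have h1 := Multiset.count_map_eq_count' _ N (Equiv.swap y y').injective (Equiv.swap y y' i)
    rw [Equiv.swap_apply_self] at h1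
    rw [h1]
    by_cases h2 : i = y
    · rw [h2, Equiv.swap_apply_left, hN]
    by_cases h3 : i = y'
    · rw [h3, Equiv.swap_apply_right, hN]
    rw [Equiv.swap_apply_of_ne_of_ne h2 h3]
  have hL : PermRel (Equiv.swap y y') (N.map fun z => 1 - lowering z).prod
      (N.map fun z => 1 - lowering z).prod := by
    have h1 := PermRel.multiset_prod N (σ := Equiv.swap y y')
      fun i _ => PermRel.one.sub (PermRel.lowering i)
    have h2 : (N.map fun z => 1 - lowering (Equiv.swap y y' z)) = N.map fun z => 1 - lowering z := by
      conv_rhs => rw [← hNσ, Multiset.map_map]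
      rfl
    rw [Equiv.symm_swap, h2] at h1
    exact h1
  have hR : PermRel (Equiv.swap y y') (∏ p ∈ Ψ, Ring.inverse (1 - raising p.1 p.2))
      (∏ p ∈ Ψ, Ring.inverse (1 - raising p.1 p.2)) := by
    have h1 := PermRel.prod Ψ (σ := Equiv.swap y y') fun p hp =>
      PermRel.inverse_one_sub_raising (hlt p hp)
        (by rw [Equiv.symm_swap]; exact hlt _ (hsymm p hp))
    have h2 : ∏ p ∈ Ψ, Ring.inverse (1 - raising (Equiv.swap y y' p.1) (Equiv.swap y y' p.2)) =
        ∏ p ∈ Ψ, Ring.inverse (1 - raising p.1 p.2) :=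
      Finset.prod_nbij' (fun p => (Equiv.swap y y' p.1, Equiv.swap y y' p.2))
        (fun p => (Equiv.swap y y' p.1, Equiv.swap y y' p.2)) hsymm hsymm
        (by simp) (by simp) (by simp)
    rw [Equiv.symm_swap, h2] at h1
    exact h1
  have h1 : katalanSeries Ψ (y' ::ₘ N) γ = (1 - lowering y') * katalanSeries Ψ N γ := by
    simp only [katalanSeries, Multiset.map_cons, Multiset.prod_cons, mul_assoc]
  rw [katalan, h1]
  refine toSym_eq_zero_of_dotSwap hy (tailBounded_katalanSeries hΨ N γ) fun δ => ?_
  rw [katalanSeries, mul_comm, coeff_mono_mul, coeff_mono_mul, ← hL.mul hR]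
  congr 2
  ext i
  simp only [Pi.sub_apply]
  by_cases h2 : i = y
  · rw [h2, Equiv.swap_apply_left, dotSwap_right hne]; linarith
  by_cases h3 : i = y'
  · rw [h3, Equiv.swap_apply_right, dotSwap_left hne]; linarith
  rw [Equiv.swap_apply_of_ne_of_ne h2 h3, dotSwap_of_ne h2 h3]

/-- Adding a root: `1 = (1 - R)⁻¹ - R (1 - R)⁻¹`. -/
theorem katalan_eq_sub_insert {ℓ : ℕ} {Ψ : Finset (Fin ℓ × Fin ℓ)} (hΨ : Ψ ⊆ posRoots ℓ)
    {i j : Fin ℓ} (hij : i < j) (hnot : (i, j) ∉ Ψ) (M : Multiset (Fin ℓ)) (γ : Fin ℓ → ℤ) :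
    katalan Ψ M γ = katalan (insert (i, j) Ψ) M γ
      - katalan (insert (i, j) Ψ) M (γ + (eps i - eps j)) := by
  have hΨ' : insert (i, j) Ψ ⊆ posRoots ℓ :=
    Finset.insert_subset (by simpa [posRoots] using hij) hΨ
  rw [katalan, katalan, katalan, ← toSym_sub (tailBounded_katalanSeries hΨ' M γ)
    (tailBounded_katalanSeries hΨ' M _)]
  congr 1
  have h1 : (1 - raising i j) * Ring.inverse (1 - raising i j) = 1 := by
    rw [inverse_one_sub_raising hij, one_sub_raising_mul hij]
  rw [katalanSeries, katalanSeries, katalanSeries, ← mono_mul_mono, ← raising,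
    Finset.prod_insert hnot]
  linear_combination (-(M.map fun z => 1 - lowering z).prod *
    (∏ p ∈ Ψ, Ring.inverse (1 - raising p.1 p.2)) * mono γ) * h1

/-- If `Ψ` is stable under exchanging `y` and `y + 1`, the additional root `(e, y + 1)` breaks this
symmetry. Up to terms which vanish by straightening, it can be traded for the symmetric pair of roots
`(e, y)`, `(e, y + 1)` at the cost of applying `R_{e, y + 1}` to the subscript. -/
theorem katalan_insert_eq {ℓ : ℕ} {y y' e : Fin ℓ} (hy : (y' : ℕ) = y + 1) (he : e < y)
    {Ψ : Finset (Fin ℓ × Fin ℓ)} (hΨ : Ψ ⊆ posRoots ℓ)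
    (hsymm : ∀ p ∈ Ψ, (Equiv.swap y y' p.1, Equiv.swap y y' p.2) ∈ Ψ)
    (h1 : (e, y) ∉ Ψ) (h2 : (e, y') ∉ Ψ)
    {M : Multiset (Fin ℓ)} (hM : M.count y' = M.count y + 1)
    {γ : Fin ℓ → ℤ} (hγ : γ y' = γ y + 1) :
    katalan (insert (e, y') Ψ) M γ =
      katalan (insert (e, y) (insert (e, y') Ψ)) M (γ + (eps e - eps y')) := by
  have hne : y ≠ y' := fun h => by rw [h] at hy; omega
  have hyy : y < y' := by rw [Fin.lt_def]; omega
  have hne1 : y ≠ e := he.ne'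
  have hne2 : y' ≠ e := (he.trans hyy).ne'
  have hΨ1 : insert (e, y') Ψ ⊆ posRoots ℓ :=
    Finset.insert_subset (by simpa [posRoots] using he.trans hyy) hΨ
  have hΨ2 : insert (e, y) (insert (e, y') Ψ) ⊆ posRoots ℓ :=
    Finset.insert_subset (by simpa [posRoots] using he) hΨ1
  have e1 := katalan_eq_sub_insert hΨ (he.trans hyy) h2 M γ
  have e2 := katalan_eq_sub_insert hΨ1 he (by simp [hne, h1]) M (γ + (eps e - eps y'))
  have e3 := katalan_eq_zero_of_swap hy hΨ hsymm hM hγ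
  have e4 : katalan (insert (e, y) (insert (e, y') Ψ)) M
      (γ + (eps e - eps y') + (eps e - eps y)) = 0 := by
    refine katalan_eq_zero_of_swap hy hΨ2 ?_ hM ?_
    · have h5 : Equiv.swap y y' e = e := Equiv.swap_apply_of_ne_of_ne hne1.symm hne2.symm
      intro p hp
      simp only [Finset.mem_insert] at hp ⊢
      rcases hp with rfl | rfl | hp
      · right; left; simp [h5]
      · left; simp [h5]
      · exact Or.inr (Or.inr (hsymm p hp))
    · simp [eps, hne1, hne2, hne, hne.symm, hγ]
  rw [e3] at e1
  rw [e4, sub_zero] at e2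
  rw [← e2]
  exact sub_eq_zero.1 e1.symm

/-! ### Katalan functions whose last subscript is negative -/

/-- All entries in position `d` of the subscripts in `F` are at most `C`. -/
def EntryLE {ℓ : ℕ} (d : Fin ℓ) (C : ℤ) (F : Subscripts ℓ) : Prop :=
  ∀ δ : Fin ℓ → ℤ, F.coeff (toLex δ) ≠ 0 → δ d ≤ C

namespace EntryLE

variable {ℓ : ℕ} {d : Fin ℓ} {C C' : ℤ} {F G : Subscripts ℓ}

theorem mul (hF : EntryLE d C F) (hG : EntryLE d C' G) : EntryLE d (C + C') (F * G) := by
  intro δ hδ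
  obtain ⟨a, ha, b, hb, hab⟩ := HahnSeries.support_mul_subset (HahnSeries.mem_support _ _ |>.2 hδ)
  have h1 := hF (ofLex a) ha
  have h2 := hG (ofLex b) hb
  have : δ = ofLex a + ofLex b := toLex.injective hab.symm
  rw [this]
  exact add_le_add h1 h2

theorem sub (hF : EntryLE d C F) (hG : EntryLE d C G) : EntryLE d C (F - G) := by
  intro δ hδ
  by_cases h1 : F.coeff (toLex δ) = 0
  · exact hG δ fun h2 => hδ (by rw [HahnSeries.coeff_sub, h1, h2, sub_zero])
  · exact hF δ h1

theorem mono {γ : Fin ℓ → ℤ} (h : γ d ≤ C) : EntryLE d C (mono γ) := by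
  intro δ hδ
  have : δ = γ := by
    by_contra hne
    exact hδ (HahnSeries.coeff_single_of_ne fun h => hne (toLex.injective h))
  rwa [this]

theorem one : EntryLE d 0 (1 : Subscripts ℓ) := mono (γ := 0) le_rfl

theorem one_sub_lowering (i : Fin ℓ) : EntryLE d 0 (1 - lowering i) := by
  refine one.sub (mono ?_)
  simp only [Pi.neg_apply, eps, Pi.single_apply]
  split_ifs <;> simp

theorem inverse_one_sub_raising {i j : Fin ℓ} (hij : i < j) (hi : i ≠ d) :
    EntryLE d 0 (Ring.inverse (1 - raising i j)) := by
  intro δ hδ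
  rw [KKSchur.inverse_one_sub_raising hij, HahnSeries.SummableFamily.coeff_hsum] at hδ
  obtain ⟨n, hn⟩ : ∃ n, ((HahnSeries.SummableFamily.powers (raising i j)) n).coeff (toLex δ) ≠ 0 := by
    by_contra! hall
    exact hδ (by simp only [hall, finsum_zero])
  rw [HahnSeries.SummableFamily.coe_powers (orderTop_raising_pos hij), raising_pow] at hn
  refine mono ?_ δ hn
  simp only [Pi.smul_apply, Pi.sub_apply, eps, Pi.single_apply, if_neg hi.symm]
  split_ifs <;> simp

end EntryLE

/-- Row `d` of the determinant `g_γ` vanishes if `d` is the last position and `γ_d < 0`. -/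
theorem g_eq_zero_of_last {ℓ : ℕ} {d : Fin ℓ} (hd : (d : ℕ) + 1 = ℓ) {γ : Fin ℓ → ℤ}
    (hγ : γ d < 0) : g γ = 0 := by
  refine Matrix.det_eq_zero_of_row_eq_zero d fun j => kh_of_neg _ ?_
  have := j.2
  omega

theorem katalan_eq_zero_of_last {ℓ : ℕ} {d : Fin ℓ} (hd : (d : ℕ) + 1 = ℓ)
    {Ψ : Finset (Fin ℓ × Fin ℓ)} (hΨ : Ψ ⊆ posRoots ℓ) (M : Multiset (Fin ℓ))
    {γ : Fin ℓ → ℤ} (hγ : γ d < 0) : katalan Ψ M γ = 0 := by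
  have h1 : EntryLE d 0 (M.map fun z => 1 - lowering z).prod := by
    induction M using Multiset.induction_on with
    | empty => simpa using EntryLE.one
    | cons a s ih =>
      simp only [Multiset.map_cons, Multiset.prod_cons]
      simpa using (EntryLE.one_sub_lowering a).mul ih
  have h2 : EntryLE d 0 (∏ p ∈ Ψ, Ring.inverse (1 - raising p.1 p.2)) := by
    refine Finset.prod_induction _ (EntryLE d 0)
      (fun _ _ hF hG => by simpa using hF.mul hG) EntryLE.one fun p hp => ?_
    have h3 : p.1 < p.2 := by simpa [posRoots] using hΨ hp
    refine EntryLE.inverse_one_sub_raising h3 fun h4 => ?_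
    have h5 := p.2.2
    rw [Fin.lt_def, h4] at h3
    omega
  have h3 : EntryLE d (γ d) (katalanSeries Ψ M γ) := by
    simpa [katalanSeries] using (h1.mul h2).mul (EntryLE.mono (γ := γ) le_rfl)
  rw [katalan, toSym]
  refine finsum_eq_zero_of_forall_eq_zero fun δ => ?_
  by_cases h4 : (katalanSeries Ψ M γ).coeff (toLex δ) = 0
  · rw [h4, zero_smul]
  · rw [g_eq_zero_of_last hd ((h3 δ h4).trans_lt hγ), smul_zero]

/-! ### The root ideal `Δ^k(λ)` and its bounce paths -/

section deltaK

variable {ℓ k : ℕ} {lam : Fin ℓ → ℤ}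

theorem deltaK_subset_posRoots : deltaK k lam ⊆ posRoots ℓ := Finset.filter_subset _ _

theorem mem_deltaK (hlam : IsBddPartition k lam) {i j : Fin ℓ} :
    (i, j) ∈ deltaK k lam ↔ (k : ℤ) - lam i + i < j := by
  have h1 := (hlam.2 i).2
  simp only [deltaK, posRoots, Finset.mem_filter, Finset.mem_univ, true_and, Fin.lt_def,
    and_iff_right_iff_imp]
  omega

/-- `down x` is the first column of row `x`: the first columns are strictly increasing, so the first
root of every row is removable. -/
theorem down_deltaK_eq_some (hlam : IsBddPartition k lam) {x j : Fin ℓ} :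
    down (deltaK k lam) x = some j ↔ (j : ℤ) = k - lam x + x + 1 := by
  have key : ∀ {x j : Fin ℓ}, IsRemovable (deltaK k lam) (x, j) →
      (j : ℤ) = k - lam x + x + 1 := by
    rintro x j ⟨hmem, -, hideal⟩
    have h1 := (mem_deltaK hlam).1 hmem
    by_contra hne
    have h2 := (hlam.2 x).2
    have hj := j.2
    have hmem' : (x, (⟨j - 1, by omega⟩ : Fin ℓ)) ∈ (deltaK k lam).erase (x, j) := by
      rw [Finset.mem_erase, mem_deltaK hlam]
      refine ⟨fun h => ?_, ?_⟩
      · have := congrArg (fun p => (p.2 : ℕ)) h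
        simp only at this
        omega
      · simp only
        omega
    have := hideal _ hmem' (x, j) (deltaK_subset_posRoots hmem) le_rfl
      (by simp only [Fin.le_def]; omega)
    exact Finset.notMem_erase _ _ this
  have key' : ∀ {x j : Fin ℓ}, (j : ℤ) = k - lam x + x + 1 → IsRemovable (deltaK k lam) (x, j) := by
    intro x j hj
    refine ⟨(mem_deltaK hlam).2 (by omega),
      (Finset.erase_subset _ _).trans deltaK_subset_posRoots, ?_⟩
    rintro ⟨p, q⟩ hpq ⟨p', q'⟩ hpq' hp hq
    simp only [Finset.mem_erase, mem_deltaK hlam, Fin.le_def, ne_eq, Prod.mk.injEq, not_and]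
      at hpq hp hq ⊢
    have h1 := hlam.1 (show p' ≤ p from hp)
    refine ⟨?_, by omega⟩
    rintro rfl rfl
    rcases (show p' ≤ p from hp).eq_or_lt with h2 | h2
    · subst h2
      exact hpq.1 rfl (Fin.ext (by omega))
    · rw [Fin.lt_def] at h2
      omega
  rw [down]
  split_ifs with h
  · rw [Option.some_inj]
    have h1 := key h.choose_spec
    refine ⟨fun h2 => h2 ▸ h1, fun h2 => Fin.ext (by omega)⟩
  · simp only [false_iff]
    exact fun h1 => h ⟨j, key' h1⟩

theorem downIter_succ_eq_some {Ψ : Finset (Fin ℓ × Fin ℓ)} {n : ℕ} {x y : Fin ℓ} :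
    downIter Ψ (n + 1) x = some y ↔ ∃ c, downIter Ψ n x = some c ∧ down Ψ c = some y := by
  rw [downIter, Function.iterate_succ_apply', Option.bind_eq_some_iff]
  rfl

theorem le_downIter (hlam : IsBddPartition k lam) {n : ℕ} {x y : Fin ℓ}
    (h : downIter (deltaK k lam) n x = some y) : (x : ℕ) + n ≤ y := by
  induction n generalizing y with
  | zero => cases h; rfl
  | succ n ih =>
    obtain ⟨c, hc, hy⟩ := downIter_succ_eq_some.1 h
    have h1 := (down_deltaK_eq_some hlam).1 hy
    have h2 := ih hc
    have h3 := (hlam.2 c).2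
    omega

theorem lt_bottom_of_mem {Ψ : Finset (Fin ℓ × Fin ℓ)} {i j : Fin ℓ} (h : (i, j) ∈ Ψ) :
    (i : ℕ) + 1 ≤ bottom Ψ := Finset.le_sup (f := fun p : Fin ℓ × Fin ℓ => (p.1 : ℕ) + 1) h

theorem mem_downSet (hlam : IsBddPartition k lam) {z j : Fin ℓ} :
    j ∈ downSet k lam z ↔ ∃ x : Fin ℓ, z ≤ x ∧ (j : ℤ) = k - lam x + x + 1 := by
  simp only [downSet, Finset.mem_filter, Finset.mem_univ, true_and, down_deltaK_eq_some hlam]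
  refine exists_congr fun x => and_congr_right fun _ => and_iff_right_of_imp fun h => ?_
  exact lt_bottom_of_mem (i := x) (j := j) ((mem_deltaK hlam).2 (by omega))

theorem count_colMultiset (Ψ : Finset (Fin ℓ × Fin ℓ)) (j : Fin ℓ) :
    (colMultiset Ψ).count j = (Finset.univ.filter fun i => (i, j) ∈ Ψ).card := by
  rw [colMultiset, Multiset.count_map]
  refine Finset.card_bij (s := Ψ.filter fun p => j = p.2) (fun p _ => p.1) ?_ ?_ ?_
  · rintro ⟨i, j'⟩ hp
    obtain ⟨hp, rfl⟩ := Finset.mem_filter.1 hp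
    simpa using hp
  · rintro ⟨i, j'⟩ hp ⟨i2, j2⟩ hp2 heq
    obtain ⟨-, rfl⟩ := Finset.mem_filter.1 hp
    obtain ⟨-, rfl⟩ := Finset.mem_filter.1 hp2
    exact Prod.ext heq rfl
  · intro i hi
    exact ⟨(i, j), by simpa using hi, rfl⟩

theorem count_weightMultiset (z j : Fin ℓ) :
    (weightMultiset k lam z).count j =
      (Finset.univ.filter fun i => (i, j) ∈ deltaK k lam).card -
        if j ∈ downSet k lam z then 1 else 0 := by
  rw [weightMultiset, Multiset.count_sub, count_colMultiset]
  congr 1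
  exact Multiset.count_eq_of_nodup (downSet k lam z).nodup

/-- If `y = down c` with `z ≤ c`, then `y + 1` occurs once more than `y` in the multiset of lowering
operators. If `y + 1` is no value of `down`, both columns have equally many roots and only `y` is
deleted once; otherwise column `y + 1` has one more root and both are deleted once. -/
theorem count_weightMultiset_succ (hlam : IsBddPartition k lam) {z c y y' : Fin ℓ}
    (hzc : z ≤ c) (hc : (y : ℤ) = k - lam c + c + 1) (hy : (y' : ℕ) = y + 1) :
    (weightMultiset k lam z).count y' = (weightMultiset k lam z).count y + 1 := by
  have h1 : y ∈ downSet k lam z := (mem_downSet hlam).2 ⟨c, hzc, hc⟩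
  have h2 : 0 < (Finset.univ.filter fun i => (i, y) ∈ deltaK k lam).card := by
    refine Finset.card_pos.2 ⟨c, ?_⟩
    simp only [Finset.mem_filter, Finset.mem_univ, true_and, mem_deltaK hlam]
    omega
  rw [count_weightMultiset, count_weightMultiset, if_pos h1]
  by_cases h3 : ∃ e : Fin ℓ, (y' : ℤ) = k - lam e + e + 1
  · obtain ⟨e, he⟩ := h3
    have hce : c < e := by
      by_contra h
      have h4 := hlam.1 (not_lt.1 h)
      have h5 : (e : ℕ) ≤ c := not_lt.1 h
      omega
    rw [if_pos ((mem_downSet hlam).2 ⟨e, hzc.trans hce.le, he⟩)]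
    have h4 : (Finset.univ.filter fun i => (i, y') ∈ deltaK k lam) =
        insert e (Finset.univ.filter fun i => (i, y) ∈ deltaK k lam) := by
      ext i
      simp only [Finset.mem_insert, Finset.mem_filter, Finset.mem_univ, true_and, mem_deltaK hlam]
      constructor
      · intro h5
        rcases lt_trichotomy i e with h6 | h6 | h6
        · have h7 := hlam.1 h6.le
          rw [Fin.lt_def] at h6
          omega
        · exact Or.inl h6
        · have h7 := hlam.1 h6.le
          rw [Fin.lt_def] at h6
          omega
      · rintro (rfl | h5) <;> omega
    rw [h4, Finset.card_insert_of_notMem]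
    · omega
    · simp only [Finset.mem_filter, Finset.mem_univ, true_and, mem_deltaK hlam]
      omega
  · have h4 : y' ∉ downSet k lam z := fun h => by
      obtain ⟨x, -, hx⟩ := (mem_downSet hlam).1 h
      exact h3 ⟨x, hx⟩
    have h5 : (Finset.univ.filter fun i => (i, y') ∈ deltaK k lam) =
        Finset.univ.filter fun i => (i, y) ∈ deltaK k lam := by
      ext i
      simp only [Finset.mem_filter, Finset.mem_univ, true_and, mem_deltaK hlam]
      refine ⟨fun h => ?_, fun h => by omega⟩
      by_contra h6
      exact h3 ⟨i, by omega⟩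
    rw [if_neg h4, h5]
    omega

/-! ### Straightening along a bounce path -/

/-- A set of roots whose rows above `y` are stable under exchanging the columns `y`, `y + 1`, and
whose rows `y`, `y + 1` agree, is stable under exchanging `y` and `y + 1`. -/
theorem swap_mem_of_rows {Ψ : Finset (Fin ℓ × Fin ℓ)} (hΨ : Ψ ⊆ posRoots ℓ) {y y' : Fin ℓ}
    (hy : (y' : ℕ) = y + 1) (hrow : ∀ j, (y, j) ∈ Ψ ↔ (y', j) ∈ Ψ)
    (hcol : ∀ i < y, ((i, y) ∈ Ψ ↔ (i, y') ∈ Ψ)) :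
    ∀ p ∈ Ψ, (Equiv.swap y y' p.1, Equiv.swap y y' p.2) ∈ Ψ := by
  have hlt : ∀ i j, (i, j) ∈ Ψ → i < j := fun i j hp => by simpa [posRoots] using hΨ hp
  have hyy : y < y' := by rw [Fin.lt_def]; omega
  have hrow_gt : ∀ j, (y, j) ∈ Ψ → y' < j := fun j hj => hlt _ _ ((hrow j).1 hj)
  rintro ⟨i, j⟩ hp
  have hij := hlt _ _ hp
  simp only
  by_cases h1 : i = y
  · subst h1
    have h2 := hrow_gt j hp
    rw [Equiv.swap_apply_left, Equiv.swap_apply_of_ne_of_ne hij.ne' h2.ne']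
    exact (hrow j).1 hp
  by_cases h2 : i = y'
  · subst h2
    rw [Equiv.swap_apply_right, Equiv.swap_apply_of_ne_of_ne (hyy.trans hij).ne' hij.ne']
    exact (hrow j).2 hp
  rw [Equiv.swap_apply_of_ne_of_ne h1 h2]
  by_cases h3 : j = y
  · subst h3
    rw [Equiv.swap_apply_left]
    exact (hcol i hij).1 hp
  by_cases h4 : j = y'
  · subst h4
    rw [Equiv.swap_apply_right]
    refine (hcol i ?_).2 hp
    rw [Fin.lt_def] at hij ⊢
    have h5 : (i : ℕ) ≠ y := fun h => h1 (Fin.ext h)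
    omega
  rwa [Equiv.swap_apply_of_ne_of_ne h3 h4]

/-- Vanishing when `y = down c` and `y + 1` is no value of `down`. -/
theorem katalan_eq_zero_of_ceiling (hlam : IsBddPartition k lam) {z c y y' : Fin ℓ}
    (hzc : z ≤ c) (hc : (y : ℤ) = k - lam c + c + 1) (hy : (y' : ℕ) = y + 1)
    (hceil : ∀ e : Fin ℓ, (y' : ℤ) ≠ k - lam e + e + 1)
    {Ψ : Finset (Fin ℓ × Fin ℓ)} (hΨ : Ψ ⊆ posRoots ℓ)
    (habove : ∀ i < y, ∀ j, (i, j) ∈ Ψ ↔ (i, j) ∈ deltaK k lam)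
    (hrow : ∀ j, (y, j) ∈ Ψ ↔ (y', j) ∈ Ψ) {γ : Fin ℓ → ℤ} (hγ : γ y' = γ y + 1) :
    katalan Ψ (weightMultiset k lam z) γ = 0 := by
  refine katalan_eq_zero_of_swap hy hΨ (swap_mem_of_rows hΨ hy hrow fun i hi => ?_)
    (count_weightMultiset_succ hlam hzc hc hy) hγ
  rw [habove i hi, habove i hi, mem_deltaK hlam, mem_deltaK hlam]
  have h1 := hceil i
  omega

/-- Vanishing along the bounce path of `z`, for `y = down^{n+1}(z)`. If `c = down^n(z)` and
`y + 1 = down (c + 1)`, then trading the root `(c + 1, y + 1)` for the symmetric pair moves the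
defect of the subscript and of the roots from `y`, `y + 1` to `c`, `c + 1`; the descent of `λ` at `z`
stops the process, and keeps consecutive positions of the path from being adjacent before that. -/
theorem katalan_eq_zero_of_downIter (hlam : IsBddPartition k lam) {z : Fin ℓ}
    (hdesc : ∀ w : Fin ℓ, (w : ℕ) = z + 1 → lam w < lam z) (n : ℕ) {y y' : Fin ℓ}
    (hiter : downIter (deltaK k lam) (n + 1) z = some y) (hy : (y' : ℕ) = y + 1)
    {Ψ : Finset (Fin ℓ × Fin ℓ)} (hΨ : Ψ ⊆ posRoots ℓ)
    (habove : ∀ i < y, ∀ j, (i, j) ∈ Ψ ↔ (i, j) ∈ deltaK k lam)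
    (hrow : ∀ j, (y, j) ∈ Ψ ↔ (y', j) ∈ Ψ) {γ : Fin ℓ → ℤ} (hγ : γ y' = γ y + 1)
    (hγlam : ∀ i < y, γ i = lam i) :
    katalan Ψ (weightMultiset k lam z) γ = 0 := by
  induction n generalizing y y' Ψ γ with
  | zero =>
    obtain ⟨c, hc, hcy⟩ := downIter_succ_eq_some.1 hiter
    obtain rfl : z = c := Option.some_inj.1 hc
    rw [down_deltaK_eq_some hlam] at hcy
    refine katalan_eq_zero_of_ceiling hlam le_rfl hcy hy (fun e he => ?_) hΨ habove hrow hγ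
    rcases le_or_gt e z with h1 | h1
    · have h2 := hlam.1 h1
      rw [Fin.le_def] at h1
      omega
    · rw [Fin.lt_def] at h1
      have h2 := hdesc ⟨z + 1, by omega⟩ rfl
      have h3 := hlam.1 (show (⟨z + 1, by omega⟩ : Fin ℓ) ≤ e from h1)
      omega
  | succ n ih =>
    obtain ⟨c, hc, hcy⟩ := downIter_succ_eq_some.1 hiter
    rw [down_deltaK_eq_some hlam] at hcy
    have hzc := le_downIter hlam hc
    have hzc' : z ≤ c := by rw [Fin.le_def]; omega
    by_cases hceil : ∀ e : Fin ℓ, (y' : ℤ) ≠ k - lam e + e + 1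
    · exact katalan_eq_zero_of_ceiling hlam hzc' hcy hy hceil hΨ habove hrow hγ
    push Not at hceil
    obtain ⟨e, he⟩ := hceil
    -- Strict monotonicity of the first columns makes `e` the successor of `c`.
    have hce : c < e := by
      by_contra h
      have h1 := hlam.1 (not_lt.1 h)
      have h2 : (e : ℕ) ≤ c := not_lt.1 h
      omega
    have hec : (e : ℕ) = c + 1 := by
      have h1 := hlam.1 hce.le
      rw [Fin.lt_def] at hce
      omega
    -- If `e = y`, then `λ` would be constant equal to `k` from `z` to `e`.
    have hey : e < y := by
      have hz1 : (z : ℕ) + 1 < ℓ := by omega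
      have h1 := hdesc ⟨z + 1, hz1⟩ rfl
      have h2 := hlam.1 (show (⟨z + 1, hz1⟩ : Fin ℓ) ≤ c by rw [Fin.le_def]; simp only; omega)
      have h3 := (hlam.2 z).2
      rw [Fin.lt_def]
      omega
    have hcy' : c < y := hce.trans hey
    have hyy : y < y' := by rw [Fin.lt_def]; omega
    have hmem : (e, y') ∈ Ψ := by
      rw [habove e hey, mem_deltaK hlam]; omega
    have hnot : (e, y) ∉ Ψ.erase (e, y') := by
      rw [Finset.mem_erase, habove e hey, mem_deltaK hlam]; omega
    have hΨ0 : Ψ.erase (e, y') ⊆ posRoots ℓ := (Finset.erase_subset _ _).trans hΨ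
    have hsymm : ∀ p ∈ Ψ.erase (e, y'),
        (Equiv.swap y y' p.1, Equiv.swap y y' p.2) ∈ Ψ.erase (e, y') := by
      refine swap_mem_of_rows hΨ0 hy (fun j => ?_) fun i hi => ?_
      · simp [hey.ne', (hey.trans hyy).ne', hrow j]
      · by_cases hie : i = e
        · subst hie
          simpa using hnot
        · have h1 : (i : ℕ) ≠ e := fun h => hie (Fin.ext h)
          simp only [Finset.mem_erase, ne_eq, Prod.mk.injEq, hie, false_and, not_false_eq_true,
            true_and, habove i hi, mem_deltaK hlam]
          refine ⟨fun h => by omega, fun h => ?_⟩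
          rcases lt_or_gt_of_ne hie with h2 | h2
          · have h3 := hlam.1 h2.le
            rw [Fin.lt_def] at h2
            omega
          · have h3 := hlam.1 h2.le
            rw [Fin.lt_def] at h2
            omega
    have hmirror := katalan_insert_eq hy hey hΨ0 hsymm hnot (Finset.notMem_erase _ _)
      (count_weightMultiset_succ hlam hzc' hcy hy) hγ
    rw [Finset.insert_erase hmem] at hmirror
    rw [hmirror]
    have hne1 := hce.ne
    have hne2 := (hcy'.trans hyy).ne
    have hne3 := (hey.trans hyy).ne
    refine ih hc hec (Finset.insert_subset (by simpa [posRoots] using hey) hΨ) ?_ ?_ ?_ ?_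
    · intro i hi j
      simp [(hi.trans hce).ne, habove i (hi.trans hcy')]
    · intro j
      simp only [Finset.mem_insert, Prod.mk.injEq, hne1, false_and, false_or, true_and,
        habove c hcy', habove e hey, mem_deltaK hlam, Fin.ext_iff]
      omega
    · have h1 : lam e = lam c := by omega
      simp [eps, hne1, hne2, hne3, hγlam c hcy', hγlam e hey, h1]
    · intro i hi
      have h1 := (hi.trans hce).ne
      have h2 := (hi.trans (hcy'.trans hyy)).ne
      simp [eps, h1, h2, hγlam i (hi.trans hcy')]

/-- Rows `i` with `b_λ ≤ i` (counted from `0`) are empty. -/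
theorem not_mem_of_bottom_le {Ψ : Finset (Fin ℓ × Fin ℓ)} {i : Fin ℓ} (h : bottom Ψ ≤ i)
    (j : Fin ℓ) : (i, j) ∉ Ψ := fun hmem => by
  have := lt_bottom_of_mem hmem
  omega

/-- Lowering an entry whose row of the root ideal is empty does not change the root ideal. -/
theorem deltaK_sub_eps (hlam : IsBddPartition k lam) {d : Fin ℓ}
    (hγ : IsBddPartition k (lam - eps d)) (hd : bottom (deltaK k lam) ≤ d) :
    deltaK k (lam - eps d) = deltaK k lam := by
  ext ⟨i, j⟩
  rw [mem_deltaK hγ, mem_deltaK hlam]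
  by_cases hi : i = d
  · subst hi
    have h1 := mt (mem_deltaK hlam).2 (not_mem_of_bottom_le hd j)
    simp only [Pi.sub_apply, eps, Pi.single_eq_same]
    omega
  · simp [eps, hi]

theorem loweringWeighted_eq_katalan (d z : Fin ℓ) :
    loweringWeighted k d lam z =
      katalan (deltaK k lam) (weightMultiset k lam z) (lam - eps d) := by
  rw [loweringWeighted, weightedSeries, lowering_mul_katalanSeries, katalan]

theorem isBddPartition_sub_eps (hlam : IsBddPartition k lam) {d : Fin ℓ} (hpos : 0 < lam d)
    (hdesc : ∀ w : Fin ℓ, (w : ℕ) = d + 1 → lam w < lam d) : IsBddPartition k (lam - eps d) := by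
  refine ⟨fun i j hij => ?_, fun i => ?_⟩
  · have h1 := hlam.1 hij
    by_cases hj : j = d
    · by_cases hi : i = d
      · rw [hi, hj]
      · simp [eps, hi, hj] at h1 ⊢
        omega
    · by_cases hi : i = d
      · subst hi
        have h2 : i < j := lt_of_le_of_ne hij (Ne.symm hj)
        rw [Fin.lt_def] at h2
        have h3 := hdesc ⟨i + 1, by omega⟩ rfl
        have h4 := hlam.1 (show (⟨i + 1, by omega⟩ : Fin ℓ) ≤ j from h2)
        simp [eps, hj]
        omega
      · simpa [eps, hi, hj] using h1
  · have h1 := hlam.2 i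
    by_cases hi : i = d
    · subst hi
      simp [eps]
      omega
    · simpa [eps, hi] using h1

end deltaK

end KKSchur

theorem proposition3p2 {ℓ k : ℕ} (lam : Fin ℓ → ℤ) (hlam : IsBddPartition k lam)
    (z : Fin ℓ) (hz : (z : ℕ) + 1 ≤ bottom (deltaK k lam))
    (a : ℕ) (ha : 1 ≤ a)
    (c : Fin ℓ) (hc : downIter (deltaK k lam) (a - 1) z = some c)
    (hcb : (c : ℕ) + 1 ≤ bottom (deltaK k lam))
    (d : Fin ℓ) (hd : downIter (deltaK k lam) a z = some d)
    (hdb : bottom (deltaK k lam) + 1 ≤ (d : ℕ) + 1) :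
    (IsBddPartition k (lam - eps d) →
      loweringWeighted k d lam z = weightedKkSchur k (lam - eps d) z) ∧
    (¬ IsBddPartition k (lam - eps d) →
      ((c : ℕ) + 1 + 1 ≤ bottom (deltaK k lam) →
        ∀ w : Fin ℓ, (w : ℕ) = (z : ℕ) + 1 → lam w < lam z) →
      loweringWeighted k d lam z = 0) := by
  have hdb' : bottom (deltaK k lam) ≤ d := by omega
  obtain ⟨n, rfl⟩ : ∃ n, a = n + 1 := ⟨a - 1, by omega⟩
  rw [Nat.add_sub_cancel] at hc
  rw [loweringWeighted_eq_katalan]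
  refine ⟨fun hγ => ?_, fun hγ hdesc => ?_⟩
  · have h1 := deltaK_sub_eps hlam hγ hdb'
    rw [weightedKkSchur, weightMultiset, weightMultiset, downSet, downSet, h1]
  have hcd : down (deltaK k lam) c = some d := by
    obtain ⟨c', hc', h⟩ := downIter_succ_eq_some.1 hd
    obtain rfl : c = c' := Option.some_inj.1 (hc.symm.trans hc')
    exact h
  rw [down_deltaK_eq_some hlam] at hcd
  have hzc := le_downIter hlam hc
  by_cases hlast : (d : ℕ) + 1 = ℓ
  · -- In the last position `λ - ε_d` can only fail to be a partition by a negative entry.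
    refine katalan_eq_zero_of_last hlast deltaK_subset_posRoots _ ?_
    by_contra h
    simp only [Pi.sub_apply, eps, Pi.single_eq_same, not_lt] at h
    exact hγ (isBddPartition_sub_eps hlam (by omega) fun w hw => by have := w.2; omega)
  have hdl : (d : ℕ) + 1 < ℓ := by have := d.2; omega
  set d' : Fin ℓ := ⟨d + 1, hdl⟩ with hd'
  have hne : d' ≠ d := fun h => by
    have := congrArg (fun i : Fin ℓ => (i : ℕ)) h
    simp [hd'] at this
  have hle : lam d' ≤ lam d := hlam.1 (by rw [Fin.le_def, hd']; simp)
  have heq : lam d' = lam d := by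
    by_contra h
    have h0 := (hlam.2 d').1
    refine hγ (isBddPartition_sub_eps hlam (by omega) fun w hw => ?_)
    obtain rfl : w = d' := Fin.ext hw
    omega
  have hrow : ∀ j, (d, j) ∈ deltaK k lam ↔ (d', j) ∈ deltaK k lam := fun j =>
    iff_of_false (not_mem_of_bottom_le hdb' j)
      (not_mem_of_bottom_le (by rw [hd']; simp only; omega) j)
  have hγd : (lam - eps d) d' = (lam - eps d) d + 1 := by
    simp [eps, hne, heq]
  by_cases hcb' : (c : ℕ) + 1 + 1 ≤ bottom (deltaK k lam)
  · exact katalan_eq_zero_of_downIter hlam (hdesc hcb') n hd rfl deltaK_subset_posRoots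
      (fun _ _ _ => Iff.rfl) hrow hγd fun i hi => by simp [eps, hi.ne]
  · -- Row `c` is the last nonempty one, so column `d + 1` does not start a row.
    refine katalan_eq_zero_of_ceiling hlam (by rw [Fin.le_def]; omega) hcd rfl (fun e he => ?_)
      deltaK_subset_posRoots (fun _ _ _ => Iff.rfl) hrow hγd
    have h1 := lt_bottom_of_mem ((mem_deltaK hlam (i := e) (j := d')).2 (by omega))
    have h2 : e ≤ c := by rw [Fin.le_def]; omega
    have h3 := hlam.1 h2
    have h4 : (d' : ℕ) = d + 1 := rfl
    rw [Fin.le_def] at h2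
    omega
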